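/- **Conventions.** Let $k>m>0$ be integers and let $\mathbb k$ be a field; homology has coefficients in $\mathbb k$. For a metric space $X$ and a finite $S\subseteq X$, $\mathrm{RP}^m(S)$ denotes the persistence diagrams, in all homological degrees, of the $m$-skeleton of the Rips filtration of $S$: the filtered complex of all nonempty $\sigma\subseteq S$ with $|\sigma|\le m+1$, where $\sigma$ appears at time $\operatorname{diam}\sigma$. If $X$ is a point cloud, i.e. is given as a (finite or infinite) subset of a Euclidean space $\mathbb R^d$, or more generally of a real normed space $E$, with the induced metric, then $\mathrm{CP}^m(S)$ denotes the persistence diagrams, in all degrees, of the $m$-skeleton of the ambient Čech filtration of $S$, where $\sigma$ appears at time $\inf\{r : \bigcap_{x\in\sigma}\bar B_E(x,r)\neq\emptyset\}$. The bottleneck distance $d_B$ between two such families of diagrams is the maximum over all degrees of the usual ($\ell^\infty$) bottleneck distances. Finally, $S(k,m)=\binom k2+\binom k3+\cdots+\binom k{m+1}$, and $d_{GH}$ is the Gromov–Hausdorff distance. **Statement.** Let $\phi:X\to Y$ be a bijection between metric spaces, let $\varepsilon,\delta\ge 0$, and let $C$ be a collection of finite subsets of $X$, each of cardinality between $k-m-1$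 and $k$, such that: * ($\delta$-dense covering property) there is a subset $X'\subseteq X$ with $|X'|\ge k$ such that $X'$ is $\delta$-dense in $X$ and $\phi(X')$ is $\delta$-dense in $Y$ (every point of the space is at distance at most $\delta$ from the subset), and such that every $\sigma\subseteq X'$ with $|\sigma|=2$ is contained in some $S\in C$ with $|S|=k$; * (closure property) if $S\in C$ has $|S|=k$ and $S'\subseteq S$ has $|S'|\ge k-m-1$, then $S'\in C$. Then: 1. (Rips case) If $d_B(\mathrm{RP}^m(S),\mathrm{RP}^m(\phi(S)))\le\varepsilon$ for all $S\in C$, then $d_{GH}(X,Y)\le 112\,k^2\varepsilon+2\delta$. 2. (Čech case) If $X$ and $Y$ are point clouds as above (in possibly different ambient spaces) and $d_B(\mathrm{CP}^m(S),\mathrm{CP}^m(\phi(S)))\le\varepsilon$ for all $S\in C$, then $d_{GH}(X,Y)\le 224\,S(k,m)\,k^{m+1}\varepsilon+2\delta$. -/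

import Mathlib

open scoped NNReal ENNReal

noncomputable section

namespace DistPers

universe u v w

/-! ### Simplicial homology of abstract simplicial complexes with field coefficients -/

section Homology

variable (𝕜 : Type w) [Field 𝕜] {V : Type u}

/-- All chains: finite formal `𝕜`-linear combinations of finite sets of vertices. -/
def Chain (𝕜 : Type w) [Field 𝕜] (V : Type u) : Type (max u w) := Finset V →₀ 𝕜

instance : AddCommGroup (Chain 𝕜 V) := inferInstanceAs (AddCommGroup (Finset V →₀ 𝕜))

instance : Module 𝕜 (Chain 𝕜 V) := inferInstanceAs (Module 𝕜 (Finset V →₀ 𝕜))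

/-- The chain consisting of `σ` with coefficient `1`. -/
def simplex (σ : Finset V) : Chain 𝕜 V := (Finsupp.single σ 1 : Finset V →₀ 𝕜)

open Classical in
/-- The boundary of `σ`. A finite set `σ` of vertices is oriented by listing its elements
increasingly for a fixed auxiliary total order (`WellOrderingRel`) on the vertices, so that deleting
`x` from `σ` carries the sign `(-1) ^ (number of elements of σ before x)`. Sets with at most one
element have boundary `0` (homology is not reduced). -/
def simplexBoundary (σ : Finset V) : Chain 𝕜 V :=
  if σ.card ≤ 1 then 0
  else ∑ x ∈ σ, (-1 : 𝕜) ^ (σ.filter fun y => WellOrderingRel y x).card • simplex 𝕜 (σ.erase x)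

/-- The simplicial boundary map, the linear extension of `simplexBoundary`. -/
def boundary : Chain 𝕜 V →ₗ[𝕜] Chain 𝕜 V :=
  (Finsupp.linearCombination 𝕜 (simplexBoundary 𝕜) : (Finset V →₀ 𝕜) →ₗ[𝕜] Chain 𝕜 V)

/-- The `n`-chains of `K`: combinations of faces of `K` with `n + 1` vertices. -/
def chains (K : PreAbstractSimplicialComplex V) (n : ℕ) : Submodule 𝕜 (Chain 𝕜 V) :=
  Submodule.span 𝕜 (simplex 𝕜 '' {σ : Finset V | σ ∈ K.faces ∧ σ.card = n + 1})

/-- The `n`-cycles of `K`. -/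
def cycles (K : PreAbstractSimplicialComplex V) (n : ℕ) : Submodule 𝕜 (Chain 𝕜 V) :=
  chains 𝕜 K n ⊓ LinearMap.ker (boundary 𝕜)

/-- The `n`-boundaries of `K`. -/
def boundaries (K : PreAbstractSimplicialComplex V) (n : ℕ) : Submodule 𝕜 (Chain 𝕜 V) :=
  (chains 𝕜 K (n + 1)).map (boundary 𝕜)

/-- The simplicial homology `H_n(K; 𝕜)`. -/
abbrev Homology (K : PreAbstractSimplicialComplex V) (n : ℕ) : Type (max u w) :=
  cycles 𝕜 K n ⧸ (boundaries 𝕜 K n).submoduleOf (cycles 𝕜 K n)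

variable {K L : PreAbstractSimplicialComplex V}

theorem chains_mono (h : K ≤ L) (n : ℕ) : chains 𝕜 K n ≤ chains 𝕜 L n :=
  Submodule.span_mono (Set.image_mono fun _ hσ => ⟨h hσ.1, hσ.2⟩)

theorem cycles_mono (h : K ≤ L) (n : ℕ) : cycles 𝕜 K n ≤ cycles 𝕜 L n :=
  inf_le_inf_right _ (chains_mono 𝕜 h n)

theorem boundaries_mono (h : K ≤ L) (n : ℕ) : boundaries 𝕜 K n ≤ boundaries 𝕜 L n :=
  Submodule.map_mono (chains_mono 𝕜 h (n + 1))

/-- The map `H_n(K) → H_n(L)` induced by an inclusion `K ≤ L`. -/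
def homologyMap (h : K ≤ L) (n : ℕ) : Homology 𝕜 K n →ₗ[𝕜] Homology 𝕜 L n :=
  Submodule.mapQ _ _ (Submodule.inclusion (cycles_mono 𝕜 h n))
    fun _ hx => boundaries_mono 𝕜 h n hx

/-- The persistent Betti number: the rank of `H_n(K) → H_n(L)`. -/
def persistentBetti (h : K ≤ L) (n : ℕ) : ℕ :=
  Module.finrank 𝕜 (LinearMap.range (homologyMap 𝕜 h n))

end Homology

/-! ### Filtered simplicial complexes and their persistence diagrams -/

/-- A filtered simplicial complex: a simplicial complex with appearance times of its faces. -/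
structure FilteredComplex (V : Type u) where
  /-- the underlying complex -/
  complex : PreAbstractSimplicialComplex V
  /-- the appearance time of a face -/
  time : Finset V → ℝ
  /-- a face does not appear before its own faces -/
  mono : ∀ σ ∈ complex.faces, ∀ τ ∈ complex.faces, σ ⊆ τ → time σ ≤ time τ

namespace FilteredComplex

variable {V : Type u} (F : FilteredComplex V)

/-- The subcomplex of the faces that have appeared by time `a`. -/
def sublevel (a : ℝ) : PreAbstractSimplicialComplex V where
  faces := {σ | σ ∈ F.complex.faces ∧ F.time σ ≤ a}
  isRelLowerSet_faces := fun σ hσ => ⟨(F.complex.isRelLowerSet_faces hσ.1).1, fun τ hτ hne =>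
    have hm := (F.complex.isRelLowerSet_faces hσ.1).2 hτ hne
    ⟨hm, (F.mono τ hm σ hσ.1 hτ).trans hσ.2⟩⟩

/-- The subcomplex of the faces that have appeared strictly before time `a`. -/
def sublevelLT (a : ℝ) : PreAbstractSimplicialComplex V where
  faces := {σ | σ ∈ F.complex.faces ∧ F.time σ < a}
  isRelLowerSet_faces := fun σ hσ => ⟨(F.complex.isRelLowerSet_faces hσ.1).1, fun τ hτ hne =>
    have hm := (F.complex.isRelLowerSet_faces hσ.1).2 hτ hne
    ⟨hm, (F.mono τ hm σ hσ.1 hτ).trans_lt hσ.2⟩⟩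

theorem sublevel_le (a : ℝ) : F.sublevel a ≤ F.complex := fun _ h => h.1

theorem sublevelLT_le (a : ℝ) : F.sublevelLT a ≤ F.complex := fun _ h => h.1

theorem sublevel_le_sublevelLT {a b : ℝ} (h : a < b) : F.sublevel a ≤ F.sublevelLT b :=
  fun _ hσ => ⟨hσ.1, hσ.2.trans_lt h⟩

theorem sublevelLT_le_sublevel {a b : ℝ} (h : a ≤ b) : F.sublevelLT a ≤ F.sublevel b :=
  fun _ hσ => ⟨hσ.1, (hσ.2.trans_le h).le⟩

theorem sublevelLT_mono {a b : ℝ} (h : a ≤ b) : F.sublevelLT a ≤ F.sublevelLT b :=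
  fun _ hσ => ⟨hσ.1, hσ.2.trans_le h⟩

theorem sublevel_mono {a b : ℝ} (h : a ≤ b) : F.sublevel a ≤ F.sublevel b :=
  fun _ hσ => ⟨hσ.1, hσ.2.trans h⟩

open Classical in
/-- The multiplicity of the dot `(a, b)` in the degree `n` persistence diagram: the number of
homology classes born exactly at time `a` and dying exactly at time `b` (never, if `b = ⊤`),
given by the usual alternating sum of persistent Betti numbers. Dots lie strictly above the
diagonal. (The differences below are nonnegative for complexes with finitely many faces.) -/
def multiplicity (𝕜 : Type w) [Field 𝕜] (n : ℕ) (a : ℝ) : WithTop ℝ → ℕ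
  | ⊤ => persistentBetti 𝕜 (F.sublevel_le a) n - persistentBetti 𝕜 (F.sublevelLT_le a) n
  | (b : ℝ) =>
    if h : a < b then
      (persistentBetti 𝕜 (F.sublevel_le_sublevelLT h) n
          + persistentBetti 𝕜 (F.sublevelLT_le_sublevel h.le) n)
        - (persistentBetti 𝕜 (F.sublevelLT_mono h.le) n
          + persistentBetti 𝕜 (F.sublevel_mono h.le) n)
    else 0

/-- The degree `n` persistence diagram, as the type of its dots, each dot `(birth, death)` being
listed according to its multiplicity. -/
def Dgm (𝕜 : Type w) [Field 𝕜] (n : ℕ) : Type :=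
  Σ p : ℝ × WithTop ℝ, Fin (F.multiplicity 𝕜 n p.1 p.2)

end FilteredComplex

/-! ### Bottleneck distance -/

/-- Two dots are at `ℓ^∞`-distance at most `η`; dots with infinite death are close only to dots
with infinite death. -/
def DotsClose (η : ℝ) : ℝ × WithTop ℝ → ℝ × WithTop ℝ → Prop
  | (a, ⊤), (a', ⊤) => |a - a'| ≤ η
  | (a, (b : ℝ)), (a', (b' : ℝ)) => |a - a'| ≤ η ∧ |b - b'| ≤ η
  | _, _ => False

/-- A dot is at `ℓ^∞`-distance at most `η` from the diagonal. -/
def NearDiagonal (η : ℝ) : ℝ × WithTop ℝ → Prop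
  | (_, ⊤) => False
  | (a, (b : ℝ)) => (b - a) / 2 ≤ η

/-- `M` is a partial matching of two families of dots of cost at most `η`: matched dots are
`η`-close and unmatched dots are `η`-close to the diagonal. -/
def IsMatching {A B : Type} (p : A → ℝ × WithTop ℝ) (q : B → ℝ × WithTop ℝ) (η : ℝ)
    (M : A ≃. B) : Prop :=
  (∀ i j, M i = some j → DotsClose η (p i) (q j)) ∧
  (∀ i, M i = none → NearDiagonal η (p i)) ∧
  (∀ j, M.symm j = none → NearDiagonal η (q j))

/-- The bottleneck distance of two families of dots. -/
def bottleneck {A B : Type} (p : A → ℝ × WithTop ℝ) (q : B → ℝ × WithTop ℝ) : ℝ≥0∞ :=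
  ⨅ (η : ℝ≥0) (_ : ∃ M : A ≃. B, IsMatching p q η M), (η : ℝ≥0∞)

/-- The bottleneck distance of the persistence of two filtered complexes: the maximum over all
homological degrees of the bottleneck distances of the persistence diagrams. -/
def bottleneckDist (𝕜 : Type w) [Field 𝕜] {V : Type u} {W : Type v}
    (F : FilteredComplex V) (G : FilteredComplex W) : ℝ≥0∞ :=
  ⨆ n : ℕ, bottleneck (fun i : F.Dgm 𝕜 n => i.1) (fun j : G.Dgm 𝕜 n => j.1)

/-! ### Rips and Čech filtrations -/

/-- The `m`-skeleton of the full simplex on a finite vertex set `S`. -/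
def skeleton {X : Type u} (m : ℕ) (S : Finset X) : PreAbstractSimplicialComplex X where
  faces := {σ | σ.Nonempty ∧ σ ⊆ S ∧ σ.card ≤ m + 1}
  isRelLowerSet_faces := fun _ hσ => ⟨hσ.1, fun _ hτ hne =>
    ⟨hne, hτ.trans hσ.2.1, (Finset.card_le_card hτ).trans hσ.2.2⟩⟩

/-- The `m`-skeleton of the Rips filtration of `S`: a simplex appears at its diameter. -/
def rips {X : Type u} [MetricSpace X] (m : ℕ) (S : Finset X) : FilteredComplex X where
  complex := skeleton m S
  time σ := Metric.diam (σ : Set X)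
  mono _ _ τ _ h := Metric.diam_mono (Finset.coe_subset.2 h) τ.finite_toSet.isBounded

/-- The appearance time of `σ` in the Čech filtration of a point cloud `ι : X → E`: the infimum of
the radii `r` for which the closed balls of radius `r` in the ambient space `E` around the points of
`σ` have a common point. -/
def cechRadius {X : Type u} {E : Type v} [NormedAddCommGroup E] (ι : X → E) (σ : Finset X) : ℝ :=
  sInf {r : ℝ | (⋂ x ∈ σ, Metric.closedBall (ι x) r).Nonempty}

theorem cechRadius_mono {X : Type u} {E : Type v} [NormedAddCommGroup E] (ι : X → E)
    {σ τ : Finset X} (hσ : σ.Nonempty) (h : σ ⊆ τ) : cechRadius ι σ ≤ cechRadius ι τ := by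
  apply csInf_le_csInf
  · obtain ⟨x, hx⟩ := hσ
    refine ⟨0, ?_⟩
    rintro r ⟨c, hc⟩
    simp only [Set.mem_iInter] at hc
    exact dist_nonneg.trans (Metric.mem_closedBall.1 (hc x hx))
  · refine ⟨∑ x ∈ τ, ‖ι x‖, 0, ?_⟩
    simp only [Set.mem_iInter, Metric.mem_closedBall, dist_zero_left]
    exact fun x hx => Finset.single_le_sum (f := fun x => ‖ι x‖) (fun _ _ => norm_nonneg _) hx
  · rintro r ⟨c, hc⟩
    simp only [Set.mem_iInter] at hc
    exact ⟨c, by simpa only [Set.mem_iInter] using fun x hx => hc x (h hx)⟩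

/-- The `m`-skeleton of the (ambient) Čech filtration of `S`, for a point cloud `ι : X → E`. -/
def cech {X : Type u} {E : Type v} [NormedAddCommGroup E] (ι : X → E) (m : ℕ) (S : Finset X) :
    FilteredComplex X where
  complex := skeleton m S
  time σ := cechRadius ι σ
  mono _ hσ _ _ h := cechRadius_mono ι hσ.1 h

/-! ### Gromov–Hausdorff distance, covering and closure properties -/

/-- The Gromov–Hausdorff distance of two metric spaces: the infimum of the Hausdorff distances of
their images under isometric embeddings into a common metric space. -/
def ghEDist (X : Type u) (Y : Type v) [MetricSpace X] [MetricSpace Y] : ℝ≥0∞ :=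
  ⨅ (Z : Type (max u v)) (_ : MetricSpace Z) (f : X → Z) (g : Y → Z)
    (_ : Isometry f) (_ : Isometry g), Metric.hausdorffEDist (Set.range f) (Set.range g)

/-- `A` is `δ`-dense in the ambient space. -/
def DeltaDense {X : Type u} [MetricSpace X] (δ : ℝ) (A : Set X) : Prop :=
  ∀ x : X, ∃ a ∈ A, dist x a ≤ δ

/-- The `δ`-dense covering property of a collection `C` of finite subsets of `X`. -/
def DenseCovering {X : Type u} {Y : Type v} [MetricSpace X] [MetricSpace Y] (φ : X ≃ Y)
    (k : ℕ) (δ : ℝ) (C : Set (Finset X)) : Prop :=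
  ∃ X' : Set X, (k : ℕ∞) ≤ X'.encard ∧ DeltaDense δ X' ∧ DeltaDense δ (φ '' X') ∧
    ∀ σ : Finset X, (σ : Set X) ⊆ X' → σ.card = 2 → ∃ S ∈ C, σ ⊆ S ∧ S.card = k

/-- The closure property of a collection `C` of finite subsets of `X`. -/
def ClosureProperty {X : Type u} (k m : ℕ) (C : Set (Finset X)) : Prop :=
  ∀ S ∈ C, S.card = k → ∀ S' ⊆ S, k - m - 1 ≤ S'.card → S' ∈ C

/-- `S(k,m) = (k choose 2) + (k choose 3) + ⋯ + (k choose m+1)`. -/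
def binomSum (k m : ℕ) : ℕ := ∑ i ∈ Finset.Icc 2 (m + 1), k.choose i

end DistPers

end

/-! The bridge from persistence to distances is the Euler characteristic. Fix $S\in C$ with $|S|=k$
and a finite set $A$ of reals containing all appearance times of faces of $S$ and of $\phi(S)$. If
$A$ misses an interval $(u,v)$ with $v-u>2\varepsilon$, a matching of cost close to $\varepsilon$
cannot change the number of dots alive at $u$ (`card_aliveDots_le`). That number is a Betti number
(`card_aliveDots`), so for every $T\subseteq S$ in $C$ the sublevel complexes of $T$ and $\phi(T)$
at $u$ have equal Betti numbers, hence equal Euler characteristics.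

An Euler characteristic is a signed sum over subsets of $T$ with at most $m+1$ elements. Equality
for all $T\subseteq S$ with $|T|\ge k-m-1$ can be inverted (`eq_zero_of_sum_powerset_eq_zero`): each
single $\sigma$ has appeared by time $u$ on one side iff it has on the other. Were the two times of
$\sigma$ more than $2\varepsilon|A|$ apart, some gap of $A$ longer than $2\varepsilon$ would
separate them (`exists_long_gap`), a contradiction (`abs_time_sub_le`).

For edges this bounds the distortion of $\phi$ on $S$. By the covering property it bounds the
distortion on all of $X'$, and gluing $X$ to $Y$ along $X'$ (`ghEDist_le`) gives the theorem, with
constants smaller than those stated. -/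

noncomputable section

namespace DistPers

universe u v w

/-! ### Simplicial chains, dimension counts and the Euler–Poincaré formula. -/

section Algebra

variable (𝕜 : Type w) [Field 𝕜] {V : Type u}

theorem linearIndependent_simplex :
    LinearIndependent 𝕜 (simplex 𝕜 : Finset V → Chain 𝕜 V) :=
  Finsupp.linearIndependent_single_one 𝕜 (Finset V)

@[simp] theorem boundary_simplex (σ : Finset V) :
    boundary 𝕜 (simplex 𝕜 σ) = simplexBoundary 𝕜 σ := by
  have := Finsupp.linearCombination_single 𝕜 (1 : 𝕜) σ (v := simplexBoundary 𝕜 (V := V))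
  rw [one_smul] at this
  exact this

theorem simplexBoundary_of_card_le_one {σ : Finset V} (h : σ.card ≤ 1) :
    simplexBoundary 𝕜 σ = 0 := if_pos h

open Classical in
theorem simplexBoundary_of_one_lt_card {σ : Finset V} (h : 1 < σ.card) :
    simplexBoundary 𝕜 σ = ∑ x ∈ σ,
      (-1 : 𝕜) ^ (σ.filter fun y => WellOrderingRel y x).card • simplex 𝕜 (σ.erase x) :=
  if_neg (not_le.2 h)

open Classical in
theorem sign_erase_of_lt {σ : Finset V} {x y : V} (hx : x ∈ σ) (h : WellOrderingRel x y) :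
    (-1 : 𝕜) ^ ((σ.erase x).filter fun z => WellOrderingRel z y).card
      = -(-1 : 𝕜) ^ (σ.filter fun z => WellOrderingRel z y).card := by
  rw [Finset.filter_erase,
    ← Finset.card_erase_add_one (Finset.mem_filter.2 ⟨hx, h⟩ : x ∈ σ.filter _), pow_succ]
  simp

open Classical in
theorem sign_erase_of_not_lt {σ : Finset V} {x y : V} (h : ¬ WellOrderingRel x y) :
    (-1 : 𝕜) ^ ((σ.erase x).filter fun z => WellOrderingRel z y).card
      = (-1 : 𝕜) ^ (σ.filter fun z => WellOrderingRel z y).card := by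
  rw [Finset.filter_erase, Finset.erase_eq_of_notMem (by simp [h])]

open Classical in
-- Deleting $x$ then $y$ cancels against deleting $y$ then $x$: exactly one of the two vertices
-- precedes the other, so exactly one of the two orders picks up an extra sign.
theorem boundary_simplexBoundary (σ : Finset V) : boundary 𝕜 (simplexBoundary 𝕜 σ) = 0 := by
  rcases le_or_gt σ.card 1 with h1 | h1
  · rw [simplexBoundary_of_card_le_one 𝕜 h1, map_zero]
  rw [simplexBoundary_of_one_lt_card 𝕜 h1, map_sum]
  simp only [map_smul, boundary_simplex]
  -- Edges are treated apart: homology is unreduced, so vertices have boundary zero and nothing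
  -- needs to cancel.
  rcases le_or_gt σ.card 2 with h2 | h2
  · refine Finset.sum_eq_zero fun x hx => ?_
    rw [simplexBoundary_of_card_le_one 𝕜, smul_zero]
    rw [Finset.card_erase_of_mem hx]; omega
  have hb : ∀ x ∈ σ, simplexBoundary 𝕜 (σ.erase x) = ∑ y ∈ σ.erase x,
      (-1 : 𝕜) ^ ((σ.erase x).filter fun z => WellOrderingRel z y).card •
        simplex 𝕜 ((σ.erase x).erase y) := fun x hx =>
    simplexBoundary_of_one_lt_card 𝕜 (by rw [Finset.card_erase_of_mem hx]; omega)
  rw [Finset.sum_congr rfl fun x hx => by rw [hb x hx, Finset.smul_sum], Finset.sum_sigma']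
  refine Finset.sum_involution (fun p _ => ⟨p.2, p.1⟩) ?_ ?_ ?_ ?_
  · rintro ⟨x, y⟩ hp
    simp only [Finset.mem_sigma, Finset.mem_erase] at hp
    obtain ⟨hx, hyx, hy⟩ := hp
    simp only [smul_smul]
    rw [Finset.erase_right_comm (a := y), ← add_smul]
    rcases trichotomous_of WellOrderingRel x y with h | h | h
    · rw [sign_erase_of_lt 𝕜 hx h, sign_erase_of_not_lt 𝕜 (asymm_of WellOrderingRel h)]
      ring_nf; simp
    · exact absurd h.symm hyx
    · rw [sign_erase_of_lt 𝕜 hy h, sign_erase_of_not_lt 𝕜 (asymm_of WellOrderingRel h)]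
      ring_nf; simp
  · rintro ⟨x, y⟩ hp _ he
    simp only [Finset.mem_sigma, Finset.mem_erase] at hp
    simp only [Sigma.mk.injEq] at he
    exact hp.2.1 he.1
  · rintro ⟨x, y⟩ hp
    simp only [Finset.mem_sigma, Finset.mem_erase] at hp ⊢
    exact ⟨hp.2.2, hp.2.1.symm, hp.1⟩
  · rintro ⟨x, y⟩ _
    rfl

theorem boundary_boundary (c : Chain 𝕜 V) : boundary 𝕜 (boundary 𝕜 c) = 0 := by
  suffices (boundary 𝕜).comp (boundary 𝕜) = (0 : Chain 𝕜 V →ₗ[𝕜] Chain 𝕜 V) from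
    LinearMap.congr_fun this c
  refine Finsupp.lhom_ext' (M := 𝕜) fun σ => LinearMap.ext_ring ?_
  have : boundary 𝕜 (boundary 𝕜 (simplex 𝕜 σ)) = 0 := by
    rw [boundary_simplex, boundary_simplexBoundary]
  exact this

variable {K L : PreAbstractSimplicialComplex V}

theorem boundaries_le_cycles (n : ℕ) : boundaries 𝕜 K n ≤ cycles 𝕜 K n := by
  classical
  refine le_inf ?_ ?_
  · rw [boundaries, Submodule.map_le_iff_le_comap, chains, Submodule.span_le]
    rintro _ ⟨σ, ⟨hσ, hc⟩, rfl⟩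
    rw [SetLike.mem_coe, Submodule.mem_comap, boundary_simplex,
      simplexBoundary_of_one_lt_card 𝕜 (by omega)]
    refine Submodule.sum_mem _ fun x hx => Submodule.smul_mem _ _ (Submodule.subset_span ?_)
    have hcard : (σ.erase x).card = n + 1 := by rw [Finset.card_erase_of_mem hx]; omega
    exact ⟨_, ⟨(K.isRelLowerSet_faces hσ).2 (Finset.erase_subset _ _)
      (Finset.card_pos.1 (by omega)), hcard⟩, rfl⟩
  · rintro _ ⟨c, _, rfl⟩
    exact boundary_boundary 𝕜 c

theorem finiteDimensional_chains (hK : K.faces.Finite) (n : ℕ) :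
    FiniteDimensional 𝕜 (chains 𝕜 K n) :=
  FiniteDimensional.span_of_finite 𝕜 ((hK.subset fun _ h => h.1).image _)

theorem finiteDimensional_cycles (hK : K.faces.Finite) (n : ℕ) :
    FiniteDimensional 𝕜 (cycles 𝕜 K n) :=
  have := finiteDimensional_chains 𝕜 hK n
  Submodule.finiteDimensional_of_le inf_le_left

theorem finrank_chains (n : ℕ) :
    Module.finrank 𝕜 (chains 𝕜 K n) = {σ | σ ∈ K.faces ∧ σ.card = n + 1}.ncard := by
  have hinj := (linearIndependent_simplex 𝕜 (V := V)).injective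
  rw [chains, Module.finrank, rank_span_set, ← Set.ncard_image_of_injective _ hinj]
  · rfl
  · exact ((linearIndependent_simplex 𝕜).linearIndepOn _).id_image

/-- Rank–nullity for $Z_n(K)\to H_n(L)$, whose kernel is $Z_n(K)\cap B_n(L)$. All multiplicities are
later computed with dimensions of such subspaces. -/
theorem finrank_persistentBetti (h : K ≤ L) (hK : K.faces.Finite) (n : ℕ) :
    persistentBetti 𝕜 h n
      + Module.finrank 𝕜 (cycles 𝕜 K n ⊓ boundaries 𝕜 L n : Submodule 𝕜 (Chain 𝕜 V))
      = Module.finrank 𝕜 (cycles 𝕜 K n) := by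
  have := finiteDimensional_cycles 𝕜 hK n
  set N := (boundaries 𝕜 K n).submoduleOf (cycles 𝕜 K n)
  have hg := LinearMap.finrank_range_add_finrank_ker ((homologyMap 𝕜 h n).comp N.mkQ)
  rw [LinearMap.range_comp_of_range_eq_top _ (Submodule.range_mkQ N)] at hg
  rw [← hg, persistentBetti]
  congr 1
  rw [← Submodule.map_comap_subtype, Submodule.finrank_map_subtype_eq]
  have : LinearMap.ker ((homologyMap 𝕜 h n).comp N.mkQ)
      = (boundaries 𝕜 L n).comap (cycles 𝕜 K n).subtype := by
    ext x
    change (Submodule.Quotient.mk (Submodule.inclusion (cycles_mono 𝕜 h n) x) : Homology 𝕜 L n) = 0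
      ↔ _
    exact Submodule.Quotient.mk_eq_zero _
  rw [this]

theorem betti_add_finrank_boundaries (hK : K.faces.Finite) (n : ℕ) :
    persistentBetti 𝕜 (le_refl K) n + Module.finrank 𝕜 (boundaries 𝕜 K n)
      = Module.finrank 𝕜 (cycles 𝕜 K n) := by
  rw [← finrank_persistentBetti 𝕜 (le_refl K) hK, inf_eq_right.2 (boundaries_le_cycles 𝕜 n)]

theorem finrank_chains_succ (hK : K.faces.Finite) (n : ℕ) :
    Module.finrank 𝕜 (chains 𝕜 K (n + 1))
      = Module.finrank 𝕜 (boundaries 𝕜 K n) + Module.finrank 𝕜 (cycles 𝕜 K (n + 1)) := by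
  have := finiteDimensional_chains 𝕜 hK (n + 1)
  rw [← LinearMap.finrank_range_add_finrank_ker ((boundary 𝕜).domRestrict (chains 𝕜 K (n + 1))),
    LinearMap.range_domRestrict, LinearMap.ker_domRestrict, cycles, ← Submodule.map_comap_subtype,
    Submodule.finrank_map_subtype_eq]
  rfl

theorem cycles_zero : cycles 𝕜 K 0 = chains 𝕜 K 0 := by
  refine inf_eq_left.2 (Submodule.span_le.2 ?_)
  rintro _ ⟨σ, ⟨_, hc⟩, rfl⟩
  exact (boundary_simplex 𝕜 σ).trans (simplexBoundary_of_card_le_one 𝕜 (by omega))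

/-- The Euler–Poincaré formula, truncated in degree `N`. -/
theorem sum_betti_eq (hK : K.faces.Finite) (N : ℕ) :
    ∑ n ∈ Finset.range (N + 1), (-1 : ℤ) ^ n * persistentBetti 𝕜 (le_refl K) n
      = ∑ n ∈ Finset.range (N + 1), (-1 : ℤ) ^ n * Module.finrank 𝕜 (chains 𝕜 K n)
        - (-1) ^ N * Module.finrank 𝕜 (boundaries 𝕜 K N) := by
  induction N with
  | zero =>
    have := betti_add_finrank_boundaries 𝕜 hK 0
    rw [cycles_zero] at this
    simp [← this]
  | succ N ih =>
    have h1 := betti_add_finrank_boundaries 𝕜 hK (N + 1)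
    rw [Finset.sum_range_succ, ih, Finset.sum_range_succ _ (N + 1), finrank_chains_succ 𝕜 hK, ← h1]
    push_cast
    ring

/-- The Euler–Poincaré formula. -/
theorem sum_betti_eq_sum_faces (A : Finset (Finset V)) (hA : K.faces = A) {N : ℕ}
    (hN : ∀ σ ∈ A, σ.card ≤ N + 1) :
    ∑ n ∈ Finset.range (N + 1), (-1 : ℤ) ^ n * persistentBetti 𝕜 (le_refl K) n
      = -∑ σ ∈ A, (-1 : ℤ) ^ σ.card := by
  classical
  have hK : K.faces.Finite := hA ▸ A.finite_toSet
  have hz : boundaries 𝕜 K N = ⊥ := by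
    rw [boundaries, chains, Set.eq_empty_of_forall_notMem (s := {σ | _ ∧ _})]
    · simp
    · rintro σ ⟨h1, h2⟩
      rw [hA] at h1
      have := hN σ h1
      omega
  rw [sum_betti_eq 𝕜 hK, hz, finrank_bot, Nat.cast_zero, mul_zero, sub_zero,
    ← Finset.sum_fiberwise_of_maps_to (t := Finset.range (N + 1)) (g := fun σ : Finset V => σ.card - 1)
      (fun σ hσ => by have := hN σ hσ; simp; omega), ← Finset.sum_neg_distrib]
  refine Finset.sum_congr rfl fun n _ => ?_
  have : {σ | σ ∈ K.faces ∧ σ.card = n + 1} = ↑(A.filter fun σ => σ.card - 1 = n) := by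
    ext σ
    simp only [hA, Set.mem_ofPred_eq, Finset.coe_filter, Finset.mem_coe]
    refine and_congr_right fun hσ => ?_
    have : 0 < σ.card := Finset.card_pos.2 (K.isRelLowerSet_faces (hA ▸ hσ : σ ∈ K.faces)).1
    omega
  have h2 : ∀ σ ∈ A.filter fun σ => σ.card - 1 = n, (-1 : ℤ) ^ σ.card = (-1) ^ (n + 1) := by
    intro σ hσ
    have h3 : σ ∈ {σ | σ ∈ K.faces ∧ σ.card = n + 1} := this ▸ hσ
    rw [h3.2]
  rw [finrank_chains, this, Set.ncard_coe_finset, Finset.sum_congr rfl h2, Finset.sum_const]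
  simp [pow_succ, mul_comm]

end Algebra

/-! ### Telescoping over critical values. -/

/-- For consecutive $a<a'$ in $A$, the elements $\le a$ are the elements $<a'$, so the sum
telescopes. Letting `Φ` depend on a set of times treats `sublevel`, `sublevelLT` and the full
complex as values of one function. -/
theorem sum_filter_le_sub_filter_lt (Φ : Finset ℝ → ℤ) (A : Finset ℝ) :
    ∑ a ∈ A, (Φ (A.filter (· ≤ a)) - Φ (A.filter (· < a))) = Φ A - Φ ∅ := by
  induction A using Finset.induction_on_max with
  | empty => simp
  | insert w A hw ih =>
    have hn : w ∉ A := fun h => lt_irrefl _ (hw w h)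
    rw [Finset.sum_insert hn]
    have h1 : (insert w A).filter (· ≤ w) = insert w A :=
      Finset.filter_true_of_mem fun x hx => by
        rcases Finset.mem_insert.1 hx with rfl | h
        exacts [le_rfl, (hw x h).le]
    have h2 : (insert w A).filter (· < w) = A := by
      rw [Finset.filter_insert, if_neg (lt_irrefl w), Finset.filter_true_of_mem hw]
    rw [h1, h2, Finset.sum_congr rfl (g := fun a => Φ (A.filter (· ≤ a)) - Φ (A.filter (· < a))), ih]
    · ring
    · intro a ha
      rw [Finset.filter_insert, if_neg (not_le.2 (hw a ha)), Finset.filter_insert,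
        if_neg (not_lt.2 (hw a ha).le)]

theorem sum_filter_le (Φ : Finset ℝ → ℤ) (A : Finset ℝ) (u : ℝ) :
    ∑ a ∈ A.filter (· ≤ u), (Φ (A.filter (· ≤ a)) - Φ (A.filter (· < a)))
      = Φ (A.filter (· ≤ u)) - Φ ∅ := by
  rw [← sum_filter_le_sub_filter_lt]
  refine Finset.sum_congr rfl fun a ha => ?_
  have hau := (Finset.mem_filter.1 ha).2
  congr 2 <;> ext x <;> simp only [Finset.mem_filter]
  · exact ⟨fun h => ⟨⟨h.1, h.2.trans hau⟩, h.2⟩, fun h => ⟨h.1.1, h.2⟩⟩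
  · exact ⟨fun h => ⟨⟨h.1, h.2.le.trans hau⟩, h.2⟩, fun h => ⟨h.1.1, h.2⟩⟩

theorem sum_filter_gt (Φ : Finset ℝ → ℤ) (A : Finset ℝ) (u : ℝ) :
    ∑ a ∈ A.filter (u < ·), (Φ (A.filter (· ≤ a)) - Φ (A.filter (· < a)))
      = Φ A - Φ (A.filter (· ≤ u)) := by
  have h1 := sum_filter_le_sub_filter_lt Φ A
  rw [← Finset.sum_filter_add_sum_filter_not A (· ≤ u), sum_filter_le] at h1
  simp only [not_le] at h1
  linarith

/-- This inequality ensures that the natural-number subtractions defining multiplicities are never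
truncated. -/
theorem finrank_add_finrank_le {K : Type*} {M : Type*} [Field K] [AddCommGroup M] [Module K M]
    {P Q R : Submodule K M} [FiniteDimensional K R] (hP : P ≤ R) (hQ : Q ≤ R) :
    Module.finrank K P + Module.finrank K Q
      ≤ Module.finrank K R + Module.finrank K (P ⊓ Q : Submodule K M) := by
  have := Submodule.finiteDimensional_of_le hP
  have := Submodule.finiteDimensional_of_le hQ
  rw [← Submodule.finrank_sup_add_finrank_inf_eq]
  exact Nat.add_le_add_right (Submodule.finrank_mono (sup_le hP hQ)) _

/-! ### Betti numbers as counts of dots alive at a given time. -/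

namespace FilteredComplex

variable {V : Type u} (F : FilteredComplex V)

/-- The subcomplex of the faces that have appeared by one of the times in `A`. -/
def sublevelFinset (A : Finset ℝ) : PreAbstractSimplicialComplex V where
  faces := {σ | σ ∈ F.complex.faces ∧ ∃ a ∈ A, F.time σ ≤ a}
  isRelLowerSet_faces := fun σ ⟨hσ, a, ha, hle⟩ =>
    ⟨(F.complex.isRelLowerSet_faces hσ).1, fun τ hτ hne =>
      have hm := (F.complex.isRelLowerSet_faces hσ).2 hτ hne
      ⟨hm, a, ha, (F.mono τ hm σ hσ hτ).trans hle⟩⟩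

theorem complex_ext {K L : PreAbstractSimplicialComplex V} (h : ∀ σ, σ ∈ K.faces ↔ σ ∈ L.faces) :
    K = L :=
  le_antisymm (fun σ => (h σ).1) fun σ => (h σ).2

variable {F} {A : Finset ℝ}

theorem sublevel_eq (hA : ∀ σ ∈ F.complex.faces, F.time σ ∈ A) (a : ℝ) :
    F.sublevel a = F.sublevelFinset (A.filter (· ≤ a)) :=
  complex_ext fun σ => and_congr_right fun hσ =>
    ⟨fun h => ⟨_, Finset.mem_filter.2 ⟨hA σ hσ, h⟩, le_rfl⟩,
      fun ⟨_, hb, h⟩ => h.trans (Finset.mem_filter.1 hb).2⟩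

theorem sublevelLT_eq (hA : ∀ σ ∈ F.complex.faces, F.time σ ∈ A) (a : ℝ) :
    F.sublevelLT a = F.sublevelFinset (A.filter (· < a)) :=
  complex_ext fun σ => and_congr_right fun hσ =>
    ⟨fun h => ⟨_, Finset.mem_filter.2 ⟨hA σ hσ, h⟩, le_rfl⟩,
      fun ⟨_, hb, h⟩ => h.trans_lt (Finset.mem_filter.1 hb).2⟩

theorem complex_eq (hA : ∀ σ ∈ F.complex.faces, F.time σ ∈ A) :
    F.complex = F.sublevelFinset A :=
  complex_ext fun σ => ⟨fun hσ => ⟨hσ, _, hA σ hσ, le_rfl⟩, fun h => h.1⟩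

theorem sublevelLT_eq_sublevel_of_notMem (hA : ∀ σ ∈ F.complex.faces, F.time σ ∈ A) {a : ℝ}
    (ha : a ∉ A) : F.sublevelLT a = F.sublevel a :=
  complex_ext fun σ => and_congr_right fun hσ =>
    ⟨le_of_lt, fun h => lt_of_le_of_ne h fun he => ha (he ▸ hA σ hσ)⟩

variable (𝕜 : Type w) [Field 𝕜] (n : ℕ)

/-- The dimension of the space of `n`-cycles. -/
def cyclesDim (K : PreAbstractSimplicialComplex V) : ℤ := Module.finrank 𝕜 (cycles 𝕜 K n)

/-- The dimension of the space of `n`-cycles of `K` that bound in `L`. -/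
def boundingDim (K L : PreAbstractSimplicialComplex V) : ℤ :=
  Module.finrank 𝕜 (cycles 𝕜 K n ⊓ boundaries 𝕜 L n : Submodule 𝕜 (Chain 𝕜 V))

theorem persistentBetti_eq {K L : PreAbstractSimplicialComplex V} (h : K ≤ L)
    (hK : K.faces.Finite) :
    (persistentBetti 𝕜 h n : ℤ) = cyclesDim 𝕜 n K - boundingDim 𝕜 n K L := by
  rw [cyclesDim, boundingDim, ← finrank_persistentBetti 𝕜 h hK]
  push_cast
  ring

theorem multiplicity_top_def (a : ℝ) :
    F.multiplicity 𝕜 n a ⊤ =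
      persistentBetti 𝕜 (F.sublevel_le a) n - persistentBetti 𝕜 (F.sublevelLT_le a) n := rfl

theorem multiplicity_coe_def {a b : ℝ} (h : a < b) :
    F.multiplicity 𝕜 n a b =
      (persistentBetti 𝕜 (F.sublevel_le_sublevelLT h) n
          + persistentBetti 𝕜 (F.sublevelLT_le_sublevel h.le) n)
        - (persistentBetti 𝕜 (F.sublevelLT_mono h.le) n
          + persistentBetti 𝕜 (F.sublevel_mono h.le) n) := dif_pos h


theorem multiplicity_top (hF : F.complex.faces.Finite) (a : ℝ) :
    (F.multiplicity 𝕜 n a ⊤ : ℤ)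
      = (cyclesDim 𝕜 n (F.sublevel a) - cyclesDim 𝕜 n (F.sublevelLT a))
        - (boundingDim 𝕜 n (F.sublevel a) F.complex
          - boundingDim 𝕜 n (F.sublevelLT a) F.complex) := by
  have h1 := persistentBetti_eq 𝕜 n (F.sublevel_le a) (hF.subset fun _ h => h.1)
  have h2 := persistentBetti_eq 𝕜 n (F.sublevelLT_le a) (hF.subset fun _ h => h.1)
  have := finiteDimensional_cycles 𝕜 (K := F.sublevel a) (hF.subset fun _ h => h.1) n
  have hle := cycles_mono 𝕜 (F.sublevelLT_le_sublevel (le_refl a)) n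
  have h3 := finrank_add_finrank_le hle
    (inf_le_left : cycles 𝕜 (F.sublevel a) n ⊓ boundaries 𝕜 F.complex n ≤ _)
  rw [← inf_assoc, inf_eq_left.2 hle] at h3
  rw [multiplicity_top_def, Nat.cast_sub]
  · linarith
  · simp only [cyclesDim, boundingDim] at h1 h2
    omega

theorem multiplicity_coe (hF : F.complex.faces.Finite) {a b : ℝ} (hab : a < b) :
    (F.multiplicity 𝕜 n a b : ℤ)
      = (boundingDim 𝕜 n (F.sublevel a) (F.sublevel b)
          - boundingDim 𝕜 n (F.sublevel a) (F.sublevelLT b))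
        - (boundingDim 𝕜 n (F.sublevelLT a) (F.sublevel b)
          - boundingDim 𝕜 n (F.sublevelLT a) (F.sublevelLT b)) := by
  have h1 := persistentBetti_eq 𝕜 n (F.sublevel_le_sublevelLT hab) (hF.subset fun _ h => h.1)
  have h2 := persistentBetti_eq 𝕜 n (F.sublevelLT_le_sublevel hab.le) (hF.subset fun _ h => h.1)
  have h3 := persistentBetti_eq 𝕜 n (F.sublevelLT_mono hab.le) (hF.subset fun _ h => h.1)
  have h4 := persistentBetti_eq 𝕜 n (F.sublevel_mono hab.le) (hF.subset fun _ h => h.1)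
  have := finiteDimensional_cycles 𝕜 (K := F.sublevel a) (hF.subset fun _ h => h.1) n
  have := Submodule.finiteDimensional_of_le
    (inf_le_left : cycles 𝕜 (F.sublevel a) n ⊓ boundaries 𝕜 (F.sublevel b) n ≤ _)
  have hZ := cycles_mono 𝕜 (F.sublevelLT_le_sublevel (le_refl a)) n
  have hB := boundaries_mono 𝕜 (F.sublevelLT_le_sublevel (le_refl b)) n
  have h5 := finrank_add_finrank_le (inf_le_inf_right (boundaries 𝕜 (F.sublevel b) n) hZ)
    (inf_le_inf_left (cycles 𝕜 (F.sublevel a) n) hB)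
  rw [inf_inf_inf_comm, inf_eq_left.2 hZ, inf_eq_right.2 hB] at h5
  rw [multiplicity_coe_def 𝕜 n hab, Nat.cast_sub]
  · push_cast
    linarith
  · simp only [boundingDim] at h1 h2 h3 h4
    omega

theorem mem_of_multiplicity_ne_zero (hA : ∀ σ ∈ F.complex.faces, F.time σ ∈ A) {a : ℝ}
    {b : WithTop ℝ} (h : F.multiplicity 𝕜 n a b ≠ 0) : a ∈ A := by
  contrapose! h
  have he := sublevelLT_eq_sublevel_of_notMem hA h
  cases b with
  | top => simp only [multiplicity, he, Nat.sub_self]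
  | coe b =>
    by_cases hab : a < b
    · simp only [multiplicity, dif_pos hab, he, Nat.sub_self]
    · simp only [multiplicity, dif_neg hab]

theorem mem_and_lt_of_multiplicity_ne_zero (hA : ∀ σ ∈ F.complex.faces, F.time σ ∈ A) {a b : ℝ}
    (h : F.multiplicity 𝕜 n a b ≠ 0) : b ∈ A ∧ a < b := by
  by_cases hab : a < b
  · refine ⟨?_, hab⟩
    contrapose! h
    have he := sublevelLT_eq_sublevel_of_notMem hA h
    simp only [multiplicity, dif_pos hab, he]
    rw [add_comm, Nat.sub_self]
  · simp only [multiplicity, dif_neg hab, ne_eq, not_true_eq_false] at h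

/-- The positions of the dots alive at time `u`. -/
def alivePositions (A : Finset ℝ) (u : ℝ) : Finset (ℝ × WithTop ℝ) :=
  A.filter (· ≤ u) ×ˢ insert ⊤ ((A.filter (u < ·)).map ⟨_, WithTop.coe_injective⟩)

/-- The dots alive at time `u`. -/
def aliveDots (F : FilteredComplex V) (A : Finset ℝ) (u : ℝ) : Finset (F.Dgm 𝕜 n) :=
  (alivePositions A u).sigma fun _ => Finset.univ

theorem mem_aliveDots (hA : ∀ σ ∈ F.complex.faces, F.time σ ∈ A) {u : ℝ} {i : F.Dgm 𝕜 n} :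
    i ∈ aliveDots 𝕜 n F A u ↔ i.1.1 ≤ u ∧ (u : WithTop ℝ) < i.1.2 := by
  have hmem : i ∈ aliveDots 𝕜 n F A u ↔ i.1 ∈ alivePositions A u :=
    Finset.mem_sigma.trans (and_iff_left (Finset.mem_univ _))
  rw [hmem]
  obtain ⟨⟨a, b⟩, x⟩ := i
  have hne : F.multiplicity 𝕜 n a b ≠ 0 := fun h => (Fin.cast h x).elim0
  have ha := mem_of_multiplicity_ne_zero 𝕜 n hA hne
  cases b with
  | top => simp [alivePositions, ha]
  | coe b =>
    have hb := (mem_and_lt_of_multiplicity_ne_zero 𝕜 n hA hne).1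
    simp [alivePositions, ha, hb]

/-- Two telescopings. For a fixed birth $a\le u$, summing over deaths beyond $u$, including
$\infty$, leaves the jump at $a$ of the rank of the map into homology at time $u$. Summing these
jumps over $a\le u$ leaves the Betti number at $u$. -/
theorem card_aliveDots (hF : F.complex.faces.Finite) (hA : ∀ σ ∈ F.complex.faces, F.time σ ∈ A) (u : ℝ) :
    (aliveDots 𝕜 n F A u).card = persistentBetti 𝕜 (le_refl (F.sublevel u)) n := by
  have hsum : ∀ a ∈ A.filter (· ≤ u),
      (∑ b ∈ insert ⊤ ((A.filter (u < ·)).map ⟨_, WithTop.coe_injective⟩),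
        (F.multiplicity 𝕜 n a b : ℤ))
      = (cyclesDim 𝕜 n (F.sublevel a) - boundingDim 𝕜 n (F.sublevel a) (F.sublevel u))
        - (cyclesDim 𝕜 n (F.sublevelLT a) - boundingDim 𝕜 n (F.sublevelLT a) (F.sublevel u)) := by
    intro a ha
    rw [Finset.sum_insert (by simp), Finset.sum_map, multiplicity_top 𝕜 n hF]
    simp only [Function.Embedding.coeFn_mk]
    rw [Finset.sum_congr rfl fun b hb => multiplicity_coe 𝕜 n hF
        ((Finset.mem_filter.1 ha).2.trans_lt (Finset.mem_filter.1 hb).2)]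
    have h1 := sum_filter_gt (fun B => boundingDim 𝕜 n (F.sublevel a) (F.sublevelFinset B)) A u
    have h2 := sum_filter_gt (fun B => boundingDim 𝕜 n (F.sublevelLT a) (F.sublevelFinset B)) A u
    simp only [← sublevel_eq hA, ← sublevelLT_eq hA, ← complex_eq hA] at h1 h2
    rw [Finset.sum_sub_distrib, h1, h2]
    ring
  have h3 := sum_filter_le (fun B => cyclesDim 𝕜 n (F.sublevelFinset B)
    - boundingDim 𝕜 n (F.sublevelFinset B) (F.sublevel u)) A u
  simp only [← sublevel_eq hA, ← sublevelLT_eq hA] at h3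
  have h4 : cyclesDim 𝕜 n (F.sublevelFinset ∅)
      - boundingDim 𝕜 n (F.sublevelFinset ∅) (F.sublevel u) = 0 := by
    have : cycles 𝕜 (F.sublevelFinset ∅) n = ⊥ := by
      simp [cycles, chains, sublevelFinset]
    rw [cyclesDim, boundingDim, this, bot_inf_eq, finrank_bot, Nat.cast_zero, sub_zero]
  have h5 := persistentBetti_eq 𝕜 n (le_refl (F.sublevel u)) (hF.subset fun _ h => h.1)
  rw [h4, ← h5, ← Finset.sum_congr rfl hsum, sub_zero] at h3
  have h6 : (aliveDots 𝕜 n F A u).card = ∑ p ∈ alivePositions A u, _ := Finset.card_sigma _ _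
  rw [h6, alivePositions, Finset.sum_product]
  simp only [Finset.card_univ, Fintype.card_fin]
  exact_mod_cast h3

end FilteredComplex

/-! ### Betti numbers under matchings of small cost. -/

theorem DotsClose.symm {η : ℝ} {p q : ℝ × WithTop ℝ} (h : DotsClose η p q) : DotsClose η q p := by
  obtain ⟨a, b⟩ := p
  obtain ⟨a', b'⟩ := q
  cases b <;> cases b' <;> simp only [DotsClose] at h ⊢
  · exact (abs_sub_comm _ _).trans_le h
  · exact ⟨(abs_sub_comm _ _).trans_le h.1, (abs_sub_comm _ _).trans_le h.2⟩

theorem IsMatching.symm {A B : Type} {p : A → ℝ × WithTop ℝ} {q : B → ℝ × WithTop ℝ} {η : ℝ}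
    {M : A ≃. B} (h : IsMatching p q η M) : IsMatching q p η M.symm :=
  ⟨fun j i hij => (h.1 i j ((PEquiv.eq_some_iff M).1 hij)).symm, h.2.2, h.2.1⟩

namespace FilteredComplex

variable {V : Type u} {W : Type v} (𝕜 : Type w) [Field 𝕜] {F : FilteredComplex V}
  {G : FilteredComplex W} {A : Finset ℝ}

/-- A dot alive at $u$ is born by $u$ and dies no earlier than $v$, so its persistence exceeds
$2\eta$ and it must be matched. Its partner's coordinates move by at most $\eta$ and cannot lie
strictly between $u$ and $v$, so the partner is alive at $u$ too. -/
theorem card_aliveDots_le (hF : ∀ σ ∈ F.complex.faces, F.time σ ∈ A)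
    (hG : ∀ σ ∈ G.complex.faces, G.time σ ∈ A) {u v η : ℝ} (huv : ∀ a ∈ A, a ≤ u ∨ v ≤ a)
    (hη : 2 * η < v - u) (n : ℕ) (M : F.Dgm 𝕜 n ≃. G.Dgm 𝕜 n)
    (hM : IsMatching (fun i : F.Dgm 𝕜 n => i.1) (fun j : G.Dgm 𝕜 n => j.1) η M) :
    (aliveDots 𝕜 n F A u).card ≤ (aliveDots 𝕜 n G A u).card := by
  refine Finset.card_le_card_of_forall_subsingleton (fun i j => M i = some j) ?_ ?_
  · intro i hi
    rw [mem_aliveDots 𝕜 n hF] at hi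
    cases hj : M i with
    | none =>
      have h := hM.2.1 i hj
      obtain ⟨⟨a, b⟩, x⟩ := i
      cases b with
      | top => exact h.elim
      | coe b =>
        have hne : F.multiplicity 𝕜 n a b ≠ 0 := fun h => (Fin.cast h x).elim0
        have hb := huv b (mem_and_lt_of_multiplicity_ne_zero 𝕜 n hF hne).1
        simp only [WithTop.coe_lt_coe] at hi
        simp only [NearDiagonal] at h
        rcases hb with hb | hb <;> linarith
    | some j =>
      refine ⟨j, ?_, rfl⟩
      rw [mem_aliveDots 𝕜 n hG]
      have h := hM.1 i j hj
      obtain ⟨⟨a, b⟩, x⟩ := i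
      obtain ⟨⟨a', b'⟩, y⟩ := j
      have hne : G.multiplicity 𝕜 n a' b' ≠ 0 := fun h => (Fin.cast h y).elim0
      have ha' := huv a' (mem_of_multiplicity_ne_zero 𝕜 n hG hne)
      have key : |a - a'| ≤ η → a' ≤ u := by
        intro h
        have h1 := abs_le.1 h
        simp only at hi
        rcases ha' with h2 | h2
        · exact h2
        · linarith
      cases b with
      | top =>
        cases b' with
        | top => exact ⟨key h, WithTop.coe_lt_top u⟩
        | coe b' => exact h.elim
      | coe b =>
        cases b' with
        | top => exact h.elim
        | coe b' =>
          refine ⟨key h.1, WithTop.coe_lt_coe.2 ?_⟩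
          have hne : F.multiplicity 𝕜 n a b ≠ 0 := fun h => (Fin.cast h x).elim0
          have hb := huv b (mem_and_lt_of_multiplicity_ne_zero 𝕜 n hF hne).1
          have h1 := abs_le.1 h.2
          have h2 := abs_nonneg (a - a')
          have h3 := h.1
          simp only [WithTop.coe_lt_coe] at hi
          rcases hb with hb | hb <;> linarith
  · intro j _ i hi i' hi'
    exact M.inj (Option.mem_def.2 hi.2) (Option.mem_def.2 hi'.2)

/-- Filtrations at small bottleneck distance have the same Betti numbers at the beginning of a long
interval without critical values. -/
theorem betti_eq_of_bottleneckDist_le (hFfin : F.complex.faces.Finite)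
    (hGfin : G.complex.faces.Finite) (hF : ∀ σ ∈ F.complex.faces, F.time σ ∈ A)
    (hG : ∀ σ ∈ G.complex.faces, G.time σ ∈ A) {u v : ℝ} {ε : ℝ≥0}
    (huv : ∀ a ∈ A, a ≤ u ∨ v ≤ a) (hε : 2 * (ε : ℝ) < v - u)
    (hd : bottleneckDist 𝕜 F G ≤ ε) (n : ℕ) :
    persistentBetti 𝕜 (le_refl (F.sublevel u)) n = persistentBetti 𝕜 (le_refl (G.sublevel u)) n := by
  -- The infimum in `bottleneck` need not be attained; the midpoint of $\varepsilon$ and $(v-u)/2$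
  -- leaves room for an actual matching.
  obtain ⟨ε', hε', h2⟩ : ∃ ε' : ℝ≥0, ε < ε' ∧ 2 * (ε' : ℝ) < v - u := by
    have h0 : 0 ≤ ((ε : ℝ) + (v - u) / 2) / 2 := by
      have := NNReal.coe_nonneg ε
      linarith
    refine ⟨_, ?_, (congrArg (2 * ·) (Real.coe_toNNReal _ h0)).trans_lt ?_⟩
    · rw [← NNReal.coe_lt_coe, Real.coe_toNNReal _ h0]
      linarith
    · linarith
  have h3 : bottleneck (fun i : F.Dgm 𝕜 n => i.1) (fun j : G.Dgm 𝕜 n => j.1) < ε' :=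
    ((le_iSup (fun n => bottleneck (fun i : F.Dgm 𝕜 n => i.1) (fun j : G.Dgm 𝕜 n => j.1)) n).trans
      hd).trans_lt (ENNReal.coe_lt_coe.2 hε')
  obtain ⟨η, ⟨M, hM⟩, hη⟩ : ∃ η : ℝ≥0, (∃ M : F.Dgm 𝕜 n ≃. G.Dgm 𝕜 n,
      IsMatching (fun i : F.Dgm 𝕜 n => i.1) (fun j : G.Dgm 𝕜 n => j.1) η M) ∧ η < ε' := by
    simpa only [bottleneck, iInf_lt_iff, ENNReal.coe_lt_coe, exists_prop] using h3
  have h4 : 2 * (η : ℝ) < v - u := by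
    have := NNReal.coe_lt_coe.2 hη
    linarith
  rw [← card_aliveDots 𝕜 n hFfin hF, ← card_aliveDots 𝕜 n hGfin hG]
  exact le_antisymm (card_aliveDots_le 𝕜 hF hG huv h4 n M hM)
    (card_aliveDots_le 𝕜 hG hF huv h4 n M.symm hM.symm)

end FilteredComplex

/-! ### Long gaps and inversion over subsets. -/

/-- Pigeonhole: if the gap from $a$ to its successor in $A$ is at most $L$, discard $a$ and continue
from the successor, losing at most $L$ in length and one point in cardinality. -/
theorem exists_long_gap {L : ℝ} (hL : 0 ≤ L) (A : Finset ℝ) {a b : ℝ} (ha : a ∈ A) (hb : b ∈ A)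
    (hab : L * A.card < b - a) :
    ∃ u v, a ≤ u ∧ v ≤ b ∧ L < v - u ∧ ∀ x ∈ A, x ≤ u ∨ v ≤ x := by
  induction A using Finset.strongInduction generalizing a with
  | H A ih =>
  have hlt : a < b := by
    have : 0 ≤ L * A.card := by positivity
    linarith
  have hne : (A.filter (a < ·)).Nonempty := ⟨b, Finset.mem_filter.2 ⟨hb, hlt⟩⟩
  obtain ⟨hvA, hav⟩ := Finset.mem_filter.1 (Finset.min'_mem _ hne)
  have hmin : ∀ x ∈ A, x ≤ a ∨ (A.filter (a < ·)).min' hne ≤ x := fun x hx =>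
    (le_or_gt x a).imp_right fun h => Finset.min'_le _ _ (Finset.mem_filter.2 ⟨hx, h⟩)
  generalize (A.filter (a < ·)).min' hne = v at hvA hav hmin
  have hvb : v ≤ b := (hmin b hb).resolve_left (not_le.2 hlt)
  by_cases hgap : L < v - a
  · exact ⟨a, v, le_rfl, hvb, hgap, hmin⟩
  · have hcard : ((A.erase a).card : ℝ) = A.card - 1 := by
      rw [← Finset.card_erase_add_one ha]; push_cast; ring
    obtain ⟨u, w, h1, h2, h3, h4⟩ := ih (A.erase a) (Finset.erase_ssubset ha)
      (Finset.mem_erase.2 ⟨hav.ne', hvA⟩) (Finset.mem_erase.2 ⟨hlt.ne', hb⟩)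
      (by rw [hcard]; linarith)
    refine ⟨u, w, hav.le.trans h1, h2, h3, fun x hx => ?_⟩
    by_cases hxa : x = a
    · exact Or.inl (hxa ▸ hav.le.trans h1)
    · exact h4 x (Finset.mem_erase.2 ⟨hxa, hx⟩)

section Inversion

variable {X : Type*} {g : Finset X → ℤ} {S : Finset X} {N M : ℕ}

/-- Moving $x$ into $A$ subtracts the relation for $B$ from the one for $B\cup\{x\}$, leaving the
subsets that contain $x$. -/
theorem sum_powerset_union_eq_zero [DecidableEq X]
    (h : ∀ T ⊆ S, N ≤ T.card → ∑ σ ∈ T.powerset, g σ = 0) (A : Finset X) :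
    ∀ B, A ⊆ S → B ⊆ S → Disjoint A B → N ≤ B.card → ∑ σ ∈ B.powerset, g (A ∪ σ) = 0 := by
  induction A using Finset.induction_on with
  | empty =>
    intro B _ hB _ hN
    simpa using h B hB hN
  | insert x A hx ih =>
    intro B hA hB hAB hN
    rw [Finset.insert_subset_iff] at hA
    rw [Finset.disjoint_insert_left] at hAB
    have h1 := ih B hA.2 hB hAB.2 hN
    have h2 := ih (insert x B) hA.2 (Finset.insert_subset hA.1 hB)
      (Finset.disjoint_insert_right.2 ⟨hx, hAB.2⟩) (hN.trans (Finset.card_le_card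
        (Finset.subset_insert _ _)))
    rw [Finset.sum_powerset_insert hAB.1, h1, zero_add] at h2
    simpa only [Finset.insert_union, Finset.union_insert] using h2

/-- Downward induction on $|\sigma|$. When $|\sigma|\le M$, the complement $S\setminus\sigma$ still
has at least $N$ elements, so the sum of $g$ over all supersets of $\sigma$ in $S$ vanishes; proper
supersets contribute zero by induction. -/
theorem eq_zero_of_sum_powerset_eq_zero (hS : N + M ≤ S.card)
    (h : ∀ T ⊆ S, N ≤ T.card → ∑ σ ∈ T.powerset, g σ = 0)
    (hg : ∀ σ, M < σ.card → g σ = 0) (σ : Finset X) (hσ : σ ⊆ S) : g σ = 0 := by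
  classical
  induction hd : S.card - σ.card using Nat.strong_induction_on generalizing σ with
  | _ d ih =>
  rcases lt_or_ge M σ.card with hM | hM
  · exact hg σ hM
  have h1 := sum_powerset_union_eq_zero h σ (S \ σ) hσ Finset.sdiff_subset
    Finset.disjoint_sdiff (by rw [Finset.card_sdiff_of_subset hσ]; omega)
  rw [Finset.sum_eq_single ∅ ?_ (by simp), Finset.union_empty] at h1
  · exact h1
  · intro ρ hρ hne
    have hρ := Finset.mem_powerset.1 hρ
    have hsub : σ ∪ ρ ⊆ S := Finset.union_subset hσ (hρ.trans Finset.sdiff_subset)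
    have hc : (σ ∪ ρ).card = σ.card + ρ.card :=
      Finset.card_union_of_disjoint (Finset.disjoint_sdiff.mono_right hρ)
    have := Finset.card_pos.2 (Finset.nonempty_iff_ne_empty.2 hne)
    have := Finset.card_le_card hsub
    exact ih _ (by omega) _ hsub rfl

end Inversion

/-! ### Comparison of appearance times. -/

section Time

variable (𝕜 : Type w) [Field 𝕜] {X : Type u} {Y : Type v}

open Classical in
/-- The Euler characteristic of a sublevel complex of a filtered skeleton. -/
theorem sum_betti_sublevel (F : FilteredComplex X) (T : Finset X) (m : ℕ)
    (hF : F.complex = skeleton m T) (u : ℝ) :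
    ∑ n ∈ Finset.range (m + 1), (-1 : ℤ) ^ n * persistentBetti 𝕜 (le_refl (F.sublevel u)) n
      = -∑ σ ∈ T.powerset, if σ.Nonempty ∧ σ.card ≤ m + 1 ∧ F.time σ ≤ u then (-1 : ℤ) ^ σ.card
        else 0 := by
  rw [sum_betti_eq_sum_faces 𝕜
    (T.powerset.filter fun σ => σ.Nonempty ∧ σ.card ≤ m + 1 ∧ F.time σ ≤ u) ?_ ?_,
    Finset.sum_filter]
  · ext σ
    simp only [FilteredComplex.sublevel, hF, skeleton, Finset.coe_filter, Finset.mem_powerset,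
      Set.mem_ofPred_eq]
    tauto
  · exact fun σ hσ => (Finset.mem_filter.1 hσ).2.2.1

theorem skeleton_finite (m : ℕ) (T : Finset X) : (skeleton m T).faces.Finite :=
  T.powerset.finite_toSet.subset fun _ h => Finset.mem_coe.2 (Finset.mem_powerset.2 h.2.1)

theorem abs_time_sub_le (φ : X ≃ Y) {k m : ℕ} (hmk : m < k) (F : Finset X → FilteredComplex X)
    (G : Finset X → FilteredComplex Y) {s : Finset X → ℝ} {t : Finset Y → ℝ}
    (hF : ∀ T, (F T).complex = skeleton m T) (hFs : ∀ T, (F T).time = s)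
    (hG : ∀ T, (G T).complex = skeleton m (T.map φ.toEmbedding)) (hGt : ∀ T, (G T).time = t)
    {S : Finset X} (hS : S.card = k) {ε : ℝ≥0}
    (hd : ∀ T ⊆ S, k - m - 1 ≤ T.card → bottleneckDist 𝕜 (F T) (G T) ≤ ε) {A : Finset ℝ}
    (hA : ∀ σ ⊆ S, σ.Nonempty → σ.card ≤ m + 1 → s σ ∈ A ∧ t (σ.map φ.toEmbedding) ∈ A)
    {σ : Finset X} (hσ : σ ⊆ S) (hne : σ.Nonempty) (hcard : σ.card ≤ m + 1) :
    |s σ - t (σ.map φ.toEmbedding)| ≤ 2 * ε * A.card := by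
  classical
  have key : ∀ u v : ℝ, (∀ a ∈ A, a ≤ u ∨ v ≤ a) → 2 * (ε : ℝ) < v - u →
      (s σ ≤ u ↔ t (σ.map φ.toEmbedding) ≤ u) := by
    intro u v huv hε
    let g : Finset X → ℤ := fun τ =>
      (if τ.Nonempty ∧ τ.card ≤ m + 1 ∧ s τ ≤ u then (-1 : ℤ) ^ τ.card else 0)
        - if τ.Nonempty ∧ τ.card ≤ m + 1 ∧ t (τ.map φ.toEmbedding) ≤ u then (-1 : ℤ) ^ τ.card
          else 0
    have hg : g σ = 0 := by
      -- Here $N+M=(k-m-1)+(m+1)=k=|S|$, which is why the closure property must reach down to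
      -- $k-m-1$.
      refine eq_zero_of_sum_powerset_eq_zero (N := k - m - 1) (M := m + 1) (S := S) (by omega)
        (fun T hT hTc => ?_) (fun τ hτ => ?_) σ hσ
      · have hb := FilteredComplex.betti_eq_of_bottleneckDist_le 𝕜 (A := A)
          (hF T ▸ skeleton_finite m T) (hG T ▸ skeleton_finite m _)
          (by
            rw [hF, hFs]
            exact fun τ hτ => (hA τ (hτ.2.1.trans hT) hτ.1 hτ.2.2).1)
          (by
            rw [hG, hGt]
            rintro τ ⟨h1, h2, h3⟩
            obtain ⟨τ, hτ, rfl⟩ := Finset.subset_map_iff.1 h2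
            rw [Finset.card_map] at h3
            exact (hA τ (hτ.trans hT) (Finset.map_nonempty.1 h1) h3).2)
          huv hε (hd T hT hTc)
        have h1 := sum_betti_sublevel 𝕜 (F T) T m (hF T) u
        have h2 := sum_betti_sublevel 𝕜 (G T) _ m (hG T) u
        simp only [hb, hFs] at h1
        rw [h1, hGt] at h2
        have h3 : (T.map φ.toEmbedding).powerset
            = T.powerset.map (Finset.mapEmbedding φ.toEmbedding).toEmbedding := by
          ext τ
          simp only [Finset.mem_powerset, Finset.subset_map_iff, Finset.mem_map]
          exact exists_congr fun _ => and_congr_right fun _ => eq_comm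
        rw [h3, Finset.sum_map] at h2
        simp only [RelEmbedding.coe_toEmbedding, Finset.mapEmbedding_apply, Finset.map_nonempty,
          Finset.card_map] at h2
        rw [Finset.sum_sub_distrib]
        linarith
      · have h1 : ¬ τ.card ≤ m + 1 := by omega
        simp only [g, h1, false_and, and_false, if_false, sub_zero]
    simp only [g, hne, hcard, true_and] at hg
    have hpow : (-1 : ℤ) ^ σ.card ≠ 0 := pow_ne_zero _ (by norm_num)
    by_cases h1 : s σ ≤ u <;> by_cases h2 : t (σ.map φ.toEmbedding) ≤ u <;>
      simp [h1, h2] at hg ⊢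
  obtain ⟨hs, ht⟩ := hA σ hσ hne hcard
  have hε0 : (0 : ℝ) ≤ 2 * ε := by positivity
  rw [abs_sub_le_iff]
  constructor <;> by_contra! hlt
  -- At the start $u$ of the gap, the face has appeared on one side but not on the other.
  · obtain ⟨u, v, h1, h2, h3, h4⟩ := exists_long_gap hε0 A ht hs hlt
    have := (key u v h4 h3).2 h1
    linarith
  · obtain ⟨u, v, h1, h2, h3, h4⟩ := exists_long_gap hε0 A hs ht hlt
    have := (key u v h4 h3).1 h1
    linarith

end Time

/-! ### From distortion on a dense subset to Gromov–Hausdorff distance. -/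

section GromovHausdorff

variable {X : Type u} {Y : Type v} [MetricSpace X] [MetricSpace Y]

/-- Glue $X$ and $Y$ by bridges of length $D+\eta$ between $x\in X'$ and $\phi(x)$. Any point
reaches the other space by a step of at most $\delta$ and one bridge. The glued metric needs a
positive bridge length, hence $\eta>0$, which is then arbitrary. -/
theorem ghEDist_le (φ : X ≃ Y) {X' : Set X} (hX' : X'.Nonempty) {δ D : ℝ≥0}
    (hX : DeltaDense δ X') (hY : DeltaDense δ (φ '' X'))
    (h : ∀ x ∈ X', ∀ y ∈ X', |dist x y - dist (φ x) (φ y)| ≤ 2 * D) :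
    ghEDist X Y ≤ D + δ := by
  refine ENNReal.le_of_forall_pos_le_add fun η hη _ => ?_
  have hr : (0 : ℝ) < D + η := add_pos_of_nonneg_of_pos D.2 hη
  have : Nonempty X' := hX'.to_subtype
  have H : ∀ p q : X', |dist (p : X) q - dist (φ p) (φ q)| ≤ 2 * (D + η) := fun p q =>
    (h p p.2 q q.2).trans (by have : (0 : ℝ) < η := hη; linarith)
  let Φ : X' → X := (↑)
  let Ψ : X' → Y := fun p => φ p
  let inst : MetricSpace (X ⊕ Y) := Metric.glueMetricApprox Φ Ψ (D + η) hr H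
  have hglue : ∀ x ∈ X', dist (Sum.inl x : X ⊕ Y) (Sum.inr (φ x)) = D + η := fun x hx =>
    Metric.glueDist_glued_points Φ Ψ (D + η) ⟨x, hx⟩
  have hbound : ∀ p q : X ⊕ Y, dist p q ≤ D + η + δ → edist p q ≤ (D + δ : ℝ≥0∞) + η := by
    intro p q hpq
    rw [edist_dist]
    refine (ENNReal.ofReal_le_ofReal hpq).trans_eq ?_
    rw [show (D + η + δ : ℝ) = ((D + δ + η : ℝ≥0) : ℝ) by push_cast; ring,
      ENNReal.ofReal_coe_nnreal]
    push_cast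
    rfl
  refine iInf_le_of_le (X ⊕ Y) (iInf_le_of_le inst (iInf_le_of_le Sum.inl (iInf_le_of_le Sum.inr
    (iInf_le_of_le (Isometry.of_dist_eq fun _ _ => rfl)
      (iInf_le_of_le (Isometry.of_dist_eq fun _ _ => rfl) ?_)))))
  refine Metric.hausdorffEDist_le_of_mem_edist ?_ ?_
  · rintro _ ⟨x, rfl⟩
    obtain ⟨a, ha, hxa⟩ := hX x
    refine ⟨_, ⟨φ a, rfl⟩, hbound _ _ ?_⟩
    have h1 : dist (Sum.inl x : X ⊕ Y) (Sum.inl a) = dist x a := rfl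
    have h2 := dist_triangle (Sum.inl x : X ⊕ Y) (Sum.inl a) (Sum.inr (φ a))
    rw [h1, hglue a ha] at h2
    linarith
  · rintro _ ⟨y, rfl⟩
    obtain ⟨_, ⟨a, ha, rfl⟩, hya⟩ := hY y
    refine ⟨_, ⟨a, rfl⟩, hbound _ _ ?_⟩
    have h1 : dist (Sum.inr y : X ⊕ Y) (Sum.inr (φ a)) = dist y (φ a) := rfl
    have h2 := dist_triangle (Sum.inr y : X ⊕ Y) (Sum.inr (φ a)) (Sum.inl a)
    rw [h1, dist_comm (Sum.inr (φ a)) (Sum.inl a : X ⊕ Y), hglue a ha] at h2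
    linarith

theorem ghEDist_le_of_denseCovering (φ : X ≃ Y) {k : ℕ} (hk : 0 < k) {δ D : ℝ≥0}
    {C : Set (Finset X)} (hC : DenseCovering φ k δ C)
    (h : ∀ S ∈ C, S.card = k → ∀ x ∈ S, ∀ y ∈ S, x ≠ y →
      |dist x y - dist (φ x) (φ y)| ≤ 2 * D) :
    ghEDist X Y ≤ D + δ := by
  classical
  obtain ⟨X', hcard, hX, hY, hcov⟩ := hC
  have hne : X'.Nonempty := by
    rw [← Set.encard_pos]
    exact lt_of_lt_of_le (by exact_mod_cast hk) hcard
  refine ghEDist_le φ hne hX hY fun x hx y hy => ?_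
  rcases eq_or_ne x y with rfl | hxy
  · simp
  · obtain ⟨S, hS, hsub, hSk⟩ := hcov {x, y} (by simp [Set.insert_subset_iff, hx, hy])
      (Finset.card_pair hxy)
    exact h S hS hSk x (hsub (by simp)) y (hsub (by simp)) hxy

end GromovHausdorff

/-! ### Rips and Čech appearance times and the resulting distortion bounds. -/

theorem exists_diam_eq_dist {X : Type u} [MetricSpace X] {σ : Finset X} (hσ : σ.Nonempty) :
    ∃ x ∈ σ, ∃ y ∈ σ, Metric.diam (σ : Set X) = dist x y := by
  obtain ⟨⟨x, y⟩, hxy, hmax⟩ :=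
    Finset.exists_max_image (σ ×ˢ σ) (fun p => dist p.1 p.2) (hσ.product hσ)
  rw [Finset.mem_product] at hxy
  refine ⟨x, hxy.1, y, hxy.2, le_antisymm ?_ ?_⟩
  · exact Metric.diam_le_of_forall_dist_le dist_nonneg fun a ha b hb =>
      hmax (a, b) (Finset.mem_product.2 ⟨ha, hb⟩)
  · exact Metric.dist_le_diam_of_mem σ.finite_toSet.isBounded hxy.1 hxy.2

section Cech

variable {X : Type u} {E : Type v} [NormedAddCommGroup E] {ι : X → E}

theorem cechRadius_eq_zero {σ : Finset X} (hσ : σ.card = 1) : cechRadius ι σ = 0 := by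
  obtain ⟨x, rfl⟩ := Finset.card_eq_one.1 hσ
  have : {r : ℝ | (⋂ y ∈ ({x} : Finset X), Metric.closedBall (ι y) r).Nonempty} = Set.Ici 0 := by
    ext r
    simp
  rw [cechRadius, this, csInf_Ici]

/-- The midpoint, available in a real normed space, attains the lower bound given by the triangle
inequality. -/
theorem cechRadius_pair [MetricSpace X] [DecidableEq X] [NormedSpace ℝ E] (hι : Isometry ι) (x y : X) :
    cechRadius ι {x, y} = dist x y / 2 := by
  have : {r : ℝ | (⋂ z ∈ ({x, y} : Finset X), Metric.closedBall (ι z) r).Nonempty}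
      = Set.Ici (dist x y / 2) := by
    ext r
    simp only [Finset.mem_insert, Finset.mem_singleton, Set.iInter_iInter_eq_or_left,
      Set.iInter_iInter_eq_left, Set.mem_ofPred_eq, Set.mem_Ici]
    constructor
    · rintro ⟨c, h1, h2⟩
      rw [Metric.mem_closedBall] at h1 h2
      have := dist_triangle_left (ι x) (ι y) c
      rw [hι.dist_eq] at this
      linarith
    · intro h
      refine ⟨midpoint ℝ (ι x) (ι y), ?_, ?_⟩
      · rw [Metric.mem_closedBall, dist_midpoint_left, hι.dist_eq, Real.norm_two]
        linarith
      · rw [Metric.mem_closedBall, dist_midpoint_right, hι.dist_eq, Real.norm_two]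
        linarith
  rw [cechRadius, this, csInf_Ici]

end Cech

section Main

variable (𝕜 : Type w) [Field 𝕜] {X : Type u} {Y : Type v} [MetricSpace X] [MetricSpace Y]

theorem abs_dist_sub_le_of_rips (φ : X ≃ Y) {k m : ℕ} (hm : 0 < m) (hmk : m < k) {S : Finset X}
    (hS : S.card = k) {ε : ℝ≥0}
    (hd : ∀ T ⊆ S, k - m - 1 ≤ T.card →
      bottleneckDist 𝕜 (rips m T) (rips m (T.map φ.toEmbedding)) ≤ ε)
    {x y : X} (hx : x ∈ S) (hy : y ∈ S) (hxy : x ≠ y) :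
    |dist x y - dist (φ x) (φ y)| ≤ 4 * k ^ 2 * ε := by
  classical
  -- Every diameter is a pairwise distance, so $2k^2$ values suffice whatever $m$ is.
  let A : Finset ℝ := (S ×ˢ S).image (fun p => dist p.1 p.2)
    ∪ (S ×ˢ S).image fun p => dist (φ p.1) (φ p.2)
  have hA : A.card ≤ 2 * k ^ 2 := by
    refine (Finset.card_union_le _ _).trans ((add_le_add Finset.card_image_le
      Finset.card_image_le).trans_eq ?_)
    rw [Finset.card_product, hS]
    ring
  have h := abs_time_sub_le 𝕜 φ hmk (rips m) (fun T => rips m (T.map φ.toEmbedding))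
    (fun _ => rfl) (fun _ => rfl) (fun _ => rfl) (fun _ => rfl) hS hd (A := A)
    (fun σ hσ hne _ => by
      constructor
      · obtain ⟨a, ha, b, hb, h⟩ := exists_diam_eq_dist hne
        rw [h]
        exact Finset.mem_union_left _ (Finset.mem_image.2
          ⟨(a, b), Finset.mem_product.2 ⟨hσ ha, hσ hb⟩, rfl⟩)
      · obtain ⟨_, ha, _, hb, h⟩ := exists_diam_eq_dist (hne.map (f := φ.toEmbedding))
        obtain ⟨a, ha', rfl⟩ := Finset.mem_map.1 ha
        obtain ⟨b, hb', rfl⟩ := Finset.mem_map.1 hb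
        rw [h]
        exact Finset.mem_union_right _ (Finset.mem_image.2
          ⟨(a, b), Finset.mem_product.2 ⟨hσ ha', hσ hb'⟩, rfl⟩))
    (σ := {x, y}) (by simp [Finset.insert_subset_iff, hx, hy]) (by simp)
    (by rw [Finset.card_pair hxy]; omega)
  simp only [Finset.map_insert, Finset.map_singleton, Finset.coe_insert, Finset.coe_singleton,
    Metric.diam_pair, Equiv.coe_toEmbedding] at h
  refine h.trans ?_
  have hA' : (A.card : ℝ) ≤ 2 * k ^ 2 := by exact_mod_cast hA
  calc 2 * ε * (A.card : ℝ) ≤ 2 * ε * (2 * k ^ 2) := by gcongr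
    _ = 4 * k ^ 2 * ε := by ring

theorem binomSum_pos {k m : ℕ} (hm : 0 < m) (hmk : m < k) : 0 < binomSum k m :=
  (Nat.choose_pos (by omega : 2 ≤ k)).trans_le
    (Finset.single_le_sum (f := fun i => k.choose i) (fun _ _ => Nat.zero_le _)
      (Finset.mem_Icc.2 ⟨le_rfl, by omega⟩))

theorem exists_finset_mem_of_mem {α : Type*} (B : Finset α) (f g : α → ℝ) :
    ∃ A : Finset ℝ, A.card ≤ 2 * B.card + 1 ∧ 0 ∈ A ∧ ∀ σ ∈ B, f σ ∈ A ∧ g σ ∈ A := by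
  refine ⟨insert 0 (B.image f ∪ B.image g), ?_, Finset.mem_insert_self _ _, fun σ hσ => ?_⟩
  · have h1 : (B.image f).card ≤ B.card := Finset.card_image_le
    have h2 : (B.image g).card ≤ B.card := Finset.card_image_le
    have h3 := Finset.card_union_le (B.image f) (B.image g)
    have h4 := Finset.card_insert_le 0 (B.image f ∪ B.image g)
    omega
  · constructor <;> apply Finset.mem_insert_of_mem
    · exact Finset.mem_union_left _ (Finset.mem_image_of_mem _ hσ)
    · exact Finset.mem_union_right _ (Finset.mem_image_of_mem _ hσ)

theorem abs_dist_sub_le_of_cech {E F : Type*} [NormedAddCommGroup E] [NormedSpace ℝ E]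
    [NormedAddCommGroup F] [NormedSpace ℝ F] {ι : X → E} {κ : Y → F} (hι : Isometry ι)
    (hκ : Isometry κ) (φ : X ≃ Y) {k m : ℕ} (hm : 0 < m) (hmk : m < k) {S : Finset X}
    (hS : S.card = k) {ε : ℝ≥0}
    (hd : ∀ T ⊆ S, k - m - 1 ≤ T.card →
      bottleneckDist 𝕜 (cech ι m T) (cech κ m (T.map φ.toEmbedding)) ≤ ε)
    {x y : X} (hx : x ∈ S) (hy : y ∈ S) (hxy : x ≠ y) :
    |dist x y - dist (φ x) (φ y)| ≤ 12 * binomSum k m * ε := by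
  classical
  obtain ⟨B, hB, hmem⟩ : ∃ B : Finset (Finset X), B.card ≤ binomSum k m ∧
      ∀ σ ⊆ S, 2 ≤ σ.card → σ.card ≤ m + 1 → σ ∈ B :=
    ⟨(Finset.Icc 2 (m + 1)).biUnion fun i => S.powersetCard i,
      Finset.card_biUnion_le.trans_eq
        (Finset.sum_congr rfl fun i _ => by rw [Finset.card_powersetCard, hS]),
      fun σ hσ h1 h2 => Finset.mem_biUnion.2
        ⟨σ.card, Finset.mem_Icc.2 ⟨h1, h2⟩, Finset.mem_powersetCard.2 ⟨hσ, rfl⟩⟩⟩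
  -- Singletons all appear at time $0$, so one extra value covers them, and $2S(k,m)+1\le 3S(k,m)$.
  -- Edges appear at half their length, which doubles the bound to $12\,S(k,m)\,\varepsilon$.
  obtain ⟨A, hA, h0, hBA⟩ := exists_finset_mem_of_mem B (cechRadius ι)
    fun σ => cechRadius κ (σ.map φ.toEmbedding)
  have htime : ∀ σ ⊆ S, σ.Nonempty → σ.card ≤ m + 1 →
      cechRadius ι σ ∈ A ∧ cechRadius κ (σ.map φ.toEmbedding) ∈ A := by
    intro σ hσ hne hc
    have := hne.card_pos
    rcases Nat.lt_or_ge 1 σ.card with h1 | h1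
    · have hσB := hmem σ hσ h1 hc
      exact hBA σ hσB
    · have h2 : σ.card = 1 := by omega
      rw [cechRadius_eq_zero h2, cechRadius_eq_zero ((Finset.card_map _).trans h2)]
      exact ⟨h0, h0⟩
  have h := abs_time_sub_le 𝕜 φ hmk (cech ι m) (fun T => cech κ m (T.map φ.toEmbedding))
    (fun _ => rfl) (fun _ => rfl) (fun _ => rfl) (fun _ => rfl) hS hd htime
    (σ := {x, y}) (by simp [Finset.insert_subset_iff, hx, hy]) (by simp)
    (by rw [Finset.card_pair hxy]; omega)
  rw [Finset.map_insert, Finset.map_singleton, cechRadius_pair hι, cechRadius_pair hκ, ← sub_div,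
    abs_div, abs_two, div_le_iff₀ two_pos] at h
  refine h.trans ?_
  have hA' : (A.card : ℝ) ≤ 3 * binomSum k m := by
    have := binomSum_pos hm hmk
    exact_mod_cast (by omega : A.card ≤ 3 * binomSum k m)
  calc 2 * ε * (A.card : ℝ) * 2 ≤ 2 * ε * (3 * binomSum k m) * 2 := by gcongr
    _ = 12 * binomSum k m * ε := by ring

end Main
end DistPers

end

theorem mainTheorem4
    (𝕜 : Type*) [Field 𝕜] {X : Type*} {Y : Type*} [MetricSpace X] [MetricSpace Y]
    (k m : ℕ) (hm : 0 < m) (hmk : m < k) (φ : X ≃ Y) (ε δ : ℝ≥0) (C : Set (Finset X))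
    (hcard : ∀ S ∈ C, k - m - 1 ≤ S.card ∧ S.card ≤ k)
    (hcover : DistPers.DenseCovering φ k δ C)
    (hclosure : DistPers.ClosureProperty k m C) :
    ((∀ S ∈ C, DistPers.bottleneckDist 𝕜
          (DistPers.rips m S) (DistPers.rips m (S.map φ.toEmbedding)) ≤ ε) →
      DistPers.ghEDist X Y ≤ 112 * (k : ℝ≥0∞) ^ 2 * ε + 2 * δ) ∧
    (∀ (E : Type*) [NormedAddCommGroup E] [NormedSpace ℝ E]
        (F : Type*) [NormedAddCommGroup F] [NormedSpace ℝ F]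
        (ι : X → E) (κ : Y → F), Isometry ι → Isometry κ →
      (∀ S ∈ C, DistPers.bottleneckDist 𝕜
          (DistPers.cech ι m S) (DistPers.cech κ m (S.map φ.toEmbedding)) ≤ ε) →
      DistPers.ghEDist X Y ≤
        224 * (DistPers.binomSum k m : ℝ≥0∞) * (k : ℝ≥0∞) ^ (m + 1) * ε + 2 * δ) := by
  have hk : 0 < k := hm.trans hmk
  have hδ : (δ : ℝ≥0∞) ≤ 2 * δ := le_mul_of_one_le_left zero_le one_le_two
  constructor
  · intro hd
    -- `D` is half the distortion bound $4k^2\varepsilon$.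
    have h := DistPers.ghEDist_le_of_denseCovering φ hk (D := 2 * k ^ 2 * ε) hcover
      fun S hS hSk x hx y hy hxy => (DistPers.abs_dist_sub_le_of_rips 𝕜 φ hm hmk hSk
        (fun T hT hTc => hd T (hclosure S hS hSk T hT hTc)) hx hy hxy).trans_eq
        (by push_cast; ring)
    refine h.trans (add_le_add ?_ hδ)
    push_cast
    gcongr
    norm_num
  · intro E _ _ F _ _ ι κ hι hκ hd
    have h := DistPers.ghEDist_le_of_denseCovering φ hk (D := 6 * DistPers.binomSum k m * ε) hcover
      fun S hS hSk x hx y hy hxy => (DistPers.abs_dist_sub_le_of_cech 𝕜 hι hκ φ hm hmk hSk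
        (fun T hT hTc => hd T (hclosure S hS hSk T hT hTc)) hx hy hxy).trans_eq
        (by push_cast; ring)
    refine h.trans (add_le_add ?_ hδ)
    -- The factor $k^{m+1}$ is pure slack: $6\,S(k,m)\,\varepsilon+\delta$ is already proved.
    have h1 : (1 : ℝ≥0∞) ≤ (k : ℝ≥0∞) ^ (m + 1) := one_le_pow₀ (by exact_mod_cast hk)
    push_cast
    refine mul_le_mul_left ?_ _
    calc (6 : ℝ≥0∞) * DistPers.binomSum k m ≤ 224 * DistPers.binomSum k m * 1 := by
          rw [mul_one]; gcongr; norm_num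
      _ ≤ _ := by gcongr
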